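/- Fix $k\ge 1$ and $d_1,\dots,d_k\in\mathbb N$. For a nonzero tensor $T\in\mathbb C^{d_1}\otimes\cdots\otimes\mathbb C^{d_k}$ let $T_\ell:\mathbb C^{d_\ell}\to\bigotimes_{j\ne\ell}\mathbb C^{d_j}$ be its $\ell$-th flattening, and let $\mu_\ell(T)=T_\ell^*T_\ell/\operatorname{Tr}(T_\ell^*T_\ell)$. For a positive semidefinite $m\times m$ matrix $M$ let $\operatorname{spec}(M)\in\mathbb R^m$ be the vector of its eigenvalues with multiplicity in non-increasing order, and put $\operatorname{spec}(\mu(T))=(\operatorname{spec}\mu_1(T),\dots,\operatorname{spec}\mu_k(T))\in\mathbb R^{d_1}\times\cdots\times\mathbb R^{d_k}$. The group $\mathrm{GL}=\mathrm{GL}_{d_1}(\mathbb C)\times\cdots\times\mathrm{GL}_{d_k}(\mathbb C)$ acts on tensors by $g\cdot T=(g_1\otimes\cdots\otimes g_k)T$. The moment polytope of $T$ is $$\Delta(T)=\{\operatorname{spec}(\mu(S)) : S\in\overline{\mathrm{GL}\cdot T}\setminus\{0\}\},$$ where the closure is Euclidean. For $c,n\in\mathbb N$ let $$\langle c\rangle_k=\sum_{j=1}^{c}e_j\otimes\cdots\otimes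 e_j\in(\mathbb C^c)^{\otimes k},\qquad \mathsf M_n^k=\sum_{i\in[n]^k}\bigotimes_{\ell=1}^{k}e_{i_\ell,i_{\ell+1}}\in(\mathbb C^{n^2})^{\otimes k},\quad i_{k+1}:=i_1,$$ be the unit tensor of rank $c$ and order $k$ and the iterated matrix multiplication tensor of order $k$, where $e_{a,b}\in\mathbb C^{n^2}$ is the standard basis vector obtained by flattening the $n\times n$ matrix unit along its rows. **Theorem.** For all natural numbers $k\ge 3$, $n$ and $c$ with $n^2-n+1<c\le n^2$, $$\Delta(\langle c\rangle_k)\not\subseteq\Delta(\mathsf M_n^k),$$ where points of $\Delta(\langle c\rangle_k)\subseteq(\mathbb R^c)^k$ are regarded as points of $(\mathbb R^{n^2})^k$ by appending $n^2-c$ zeros to each of their $k$ components. -/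

import Mathlib

/-- Order-`k` tensors of format `d`, i.e. elements of `ℂ^(d 0) ⊗ ⋯ ⊗ ℂ^(d (k - 1))`, given by their
coordinates in the standard product basis. The topology is the product (= Euclidean) one. -/
abbrev KTensor {k : ℕ} (d : Fin k → ℕ) : Type := (∀ l, Fin (d l)) → ℂ

namespace KTensor

variable {k : ℕ} {d : Fin k → ℕ}

/-- The simple tensor `v 0 ⊗ ⋯ ⊗ v (k - 1)`. -/
def pure (v : ∀ l, Fin (d l) → ℂ) : KTensor d := fun x => ∏ l, v l (x l)

/-- The action of `GL = GL_(d 0) × ⋯ × GL_(d (k - 1))` by local basis transformations,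
`(g 0 ⊗ ⋯ ⊗ g (k - 1)) T`. -/
def glAct (g : ∀ l, GL (Fin (d l)) ℂ) (T : KTensor d) : KTensor d :=
  fun x => ∑ y : (∀ l, Fin (d l)), (∏ l, (g l : Matrix (Fin (d l)) (Fin (d l)) ℂ) (x l) (y l)) * T y

/-- The orbit `GL ⬝ T`. -/
def glOrbit (T : KTensor d) : Set (KTensor d) := Set.range fun g => glAct g T

/-- The matrix of the `l`-th flattening `T_l : ℂ^(d l) → ⨂_{j ≠ l} ℂ^(d j)`. -/
def flatten (T : KTensor d) (l : Fin k) :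
    Matrix (∀ j : {j // j ≠ l}, Fin (d j)) (Fin (d l)) ℂ :=
  Matrix.of fun r a => T ((Equiv.piSplitAt l fun j => Fin (d j)).symm (a, r))

/-- The `l`-th component `T_l^* T_l / Tr(T_l^* T_l)` of the moment map (for `T ≠ 0`). -/
noncomputable def marginal (T : KTensor d) (l : Fin k) : Matrix (Fin (d l)) (Fin (d l)) ℂ :=
  ((T.flatten l).conjTranspose * T.flatten l).trace⁻¹ •
    ((T.flatten l).conjTranspose * T.flatten l)

theorem marginal_isHermitian (T : KTensor d) (l : Fin k) : (T.marginal l).IsHermitian := by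
  have h := Matrix.isHermitian_conjTranspose_mul_self (T.flatten l)
  unfold marginal
  rw [Matrix.IsHermitian, Matrix.conjTranspose_smul, h.eq, star_inv₀, ← Matrix.trace_conjTranspose,
    h.eq]

end KTensor

/-- The eigenvalues of a Hermitian matrix with multiplicity, in non-increasing order. -/
noncomputable def hermitianSpec {m : ℕ} {M : Matrix (Fin m) (Fin m) ℂ} (hM : M.IsHermitian) :
    Fin m → ℝ :=
  fun i => hM.eigenvalues₀ (Fin.cast (Fintype.card_fin m).symm i)

namespace KTensor

variable {k : ℕ} {d : Fin k → ℕ}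

/-- `spec(μ(T))`, a point of `ℝ^(d 0) × ⋯ × ℝ^(d (k - 1))`. -/
noncomputable def specMoment (T : KTensor d) : ∀ l, Fin (d l) → ℝ :=
  fun l => hermitianSpec (T.marginal_isHermitian l)

/-- `Δ(W) = {spec(μ(S)) | S ∈ W \ {0}}`. -/
def momentPolytopeOf (W : Set (KTensor d)) : Set (∀ l, Fin (d l) → ℝ) :=
  specMoment '' (W \ {0})

/-- The moment polytope `Δ(T)` of a tensor, i.e. that of its `GL`-orbit closure. -/
def momentPolytope (T : KTensor d) : Set (∀ l, Fin (d l) → ℝ) :=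
  momentPolytopeOf (closure T.glOrbit)

end KTensor

/-- The unit tensor `∑_j e_j ⊗ ⋯ ⊗ e_j` of rank `r` and order `k`. -/
def unitTensor (r k : ℕ) : KTensor fun _ : Fin k => r :=
  ∑ j : Fin r, KTensor.pure fun _ => Pi.single j 1

/-- The standard basis matrix `e_{a,b}`, flattened along the rows to a vector of length `n²`. -/
def matUnitVec {n : ℕ} (a b : Fin n) : Fin (n ^ 2) → ℂ :=
  Pi.single (Fin.cast (pow_two n).symm (finProdFinEquiv (a, b))) 1

/-- The iterated matrix multiplication tensor `∑_{i ∈ [n]^k} ⨂_l e_{i_l, i_{l+1}}`, where the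
successor `l + 1` is taken cyclically (`finRotate`). -/
def immTensor (n k : ℕ) : KTensor fun _ : Fin k => n ^ 2 :=
  ∑ i : Fin k → Fin n, KTensor.pure fun l => matUnitVec (i l) (i (finRotate k l))

/-- Padding of every component of a point with zeros at the end (used for `d l ≤ d' l`). -/
def zeroPad {k : ℕ} {d : Fin k → ℕ} (d' : Fin k → ℕ) (p : ∀ l, Fin (d l) → ℝ) :
    ∀ l, Fin (d' l) → ℝ :=
  fun l i => if h : (i : ℕ) < d l then p l ⟨i, h⟩ else 0

/-! ### Spectra of Hermitian matrices -/

/-! Put `m = c - 1`, so that `m > n² - n`. The separating point has uniform marginals of ranks `(2,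
m, m + 1, 1, …, 1)`, those of a generic `m × (m + 1)` matrix pencil.

This point lies in the polytope of the unit tensor (`uniformVec_mem_momentPolytope_unitTensor`).
Evaluation at `m + 1` nodes followed by interpolation exhibits multiplication of polynomials of
degree at most `1` by polynomials of degree less than `m` as a restriction of the unit tensor of
rank `m + 1`. Diagonal scaling gives it squared coefficients `m - b` at `(0, b, b)` and `b + 1` at
`(1, b, b + 1)`. Its marginals are then diagonal, with entries `m(m + 1)/2`, `m + 1` and `m` on the
first three factors.

It does not lie in the polytope of iterated matrix multiplication, for two incompatible reasons. (1)
Contracting the first factor with a vector leaves left multiplication by an `n × n` matrix. Every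
pencil of such matrices has a nonzero member with a kernel vector `h`, and this member annihilates
the `n`-dimensional space of all `h yᵀ` in the second factor. That space meets every subspace of
codimension less than `n`, in particular every `m`-dimensional one. The resulting condition is
invariant under the group and closed, so it holds on the orbit closure
(`exists_eval_eq_zero_of_mem_closure`). (2) Suppose some combination of the two slices of a tensor
with the above marginals had a left kernel vector `w` in the `m`-dimensional support. All the mass
of `w`, proportional to `1/m`, would then lie in a single direction of the pencil and a single
direction of the third factor. That factor carries only `1/(m + 1)` in each direction, contradicting
Cauchy–Schwarz (`pencil_vecMul_ne_zero`). -/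

theorem hermitianSpec_eq_of_diagonal {m : ℕ} {M : Matrix (Fin m) (Fin m) ℂ} (hM : M.IsHermitian)
    {p : Fin m → ℝ} (hp : Antitone p) (h : M = Matrix.diagonal fun i => (p i : ℂ)) :
    hermitianSpec hM = p := by
  have hanti : Antitone (hermitianSpec hM) := fun _ _ hij => hM.eigenvalues₀_antitone hij
  have h1 : M.charpoly.roots = Multiset.map (fun i => (p i : ℂ)) Finset.univ.val := by
    rw [h, Matrix.charpoly_diagonal, Polynomial.roots_prod]
    · simp
    · simp [Finset.prod_ne_zero_iff, Polynomial.X_sub_C_ne_zero]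
  have h2 : M.charpoly.roots =
      Multiset.map (fun i => (hermitianSpec hM i : ℂ)) Finset.univ.val := by
    rw [hM.roots_charpoly_eq_eigenvalues₀]
    rw [← Multiset.map_univ_val_equiv (finCongr (Fintype.card_fin m).symm), Multiset.map_map]
    rfl
  have h3 : Multiset.map (hermitianSpec hM) Finset.univ.val = Multiset.map p Finset.univ.val := by
    have := congrArg (Multiset.map Complex.re) (h2.symm.trans h1)
    simpa [Multiset.map_map, Function.comp_def] using this
  -- Both lists are sorted, so equality up to permutation is equality.
  rw [Fin.univ_val_map, Fin.univ_val_map, Multiset.coe_eq_coe] at h3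
  exact List.ofFn_injective (h3.eq_of_sortedGE hanti.sortedGE_ofFn hp.sortedGE_ofFn)

theorem exists_unitary_conj_eq_diagonal_hermitianSpec {m : ℕ} {M : Matrix (Fin m) (Fin m) ℂ}
    (hM : M.IsHermitian) :
    ∃ U : Matrix (Fin m) (Fin m) ℂ, U.conjTranspose * U = 1 ∧
      U.conjTranspose * M * U = Matrix.diagonal fun i => (hermitianSpec hM i : ℂ) := by
  -- `eigenvalues` is `eigenvalues₀` reindexed along an arbitrary bijection; `σ` reorders the
  -- eigenvector columns so that the sorted order returns.
  let σ : Fin m ≃ Fin m := (finCongr (Fintype.card_fin m).symm).trans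
    (Fintype.equivOfCardEq (Fintype.card_fin _))
  let V : Matrix (Fin m) (Fin m) ℂ := hM.eigenvectorUnitary
  have hV : V.conjTranspose * V = 1 := Unitary.coe_star_mul_self hM.eigenvectorUnitary
  have hD : V.conjTranspose * M * V =
      Matrix.diagonal (RCLike.ofReal ∘ hM.eigenvalues) := by
    have := hM.conjStarAlgAut_star_eigenvectorUnitary
    rwa [Unitary.conjStarAlgAut_star_apply] at this
  refine ⟨V.submatrix id σ, ?_, ?_⟩
  · have : (V.submatrix id σ).conjTranspose * V.submatrix id σ =
        (V.conjTranspose * V).submatrix σ σ := by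
      ext i j; simp [Matrix.mul_apply]
    rw [this, hV, Matrix.submatrix_one_equiv]
  · have : (V.submatrix id σ).conjTranspose * M * V.submatrix id σ =
        (V.conjTranspose * M * V).submatrix σ σ := by
      ext i j; simp [Matrix.mul_apply]
    rw [this, hD]
    ext i j
    simp only [Matrix.submatrix_apply, Matrix.diagonal_apply, EmbeddingLike.apply_eq_iff_eq,
      Function.comp_apply, Matrix.IsHermitian.eigenvalues, hermitianSpec]
    simp [σ]

namespace KTensor

/-! ### Local matrix actions and orbit closures -/

section Action

variable {k : ℕ} {d : Fin k → ℕ}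

/-- The action of tuples of arbitrary square matrices, extending `glAct`. -/
def matAct (A : ∀ l, Matrix (Fin (d l)) (Fin (d l)) ℂ) (T : KTensor d) : KTensor d :=
  fun x => ∑ y : (∀ l, Fin (d l)), (∏ l, A l (x l) (y l)) * T y

theorem sum_prod_mul_prod {ι : Type*} [Fintype ι] [DecidableEq ι] {m n o : ι → Type*}
    [∀ i, Fintype (n i)] (A : ∀ i, Matrix (m i) (n i) ℂ) (B : ∀ i, Matrix (n i) (o i) ℂ)
    (x : ∀ i, m i) (z : ∀ i, o i) :
    ∑ y : ∀ i, n i, (∏ i, A i (x i) (y i)) * ∏ i, B i (y i) (z i) =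
      ∏ i, (A i * B i) (x i) (z i) := by
  simp_rw [Matrix.mul_apply, Fintype.prod_sum, Finset.prod_mul_distrib]

theorem matAct_matAct (A B : ∀ l, Matrix (Fin (d l)) (Fin (d l)) ℂ) (T : KTensor d) :
    matAct A (matAct B T) = matAct (fun l => A l * B l) T := by
  funext x
  simp only [matAct, Finset.mul_sum]
  rw [Finset.sum_comm]
  refine Finset.sum_congr rfl fun z _ => ?_
  rw [← sum_prod_mul_prod, Finset.sum_mul]
  exact Finset.sum_congr rfl fun y _ => (mul_assoc _ _ _).symm

theorem continuous_matAct (A : ∀ l, Matrix (Fin (d l)) (Fin (d l)) ℂ) :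
    Continuous (matAct (d := d) A) := by
  unfold matAct
  fun_prop

open Filter Topology in
theorem eventually_isUnit_add_smul_one {m : ℕ} (A : Matrix (Fin m) (Fin m) ℂ) :
    ∀ᶠ ε : ℂ in 𝓝[≠] 0, IsUnit (A + ε • (1 : Matrix (Fin m) (Fin m) ℂ)) := by
  have hfin : (spectrum ℂ (-A)).Finite := (-A).finite_spectrum
  have : ∀ᶠ ε : ℂ in 𝓝[≠] 0, ε ∉ spectrum ℂ (-A) := by
    -- The value `0` may belong to the spectrum; it is removed to obtain a neighbourhood of `0`, and
    -- the punctured filter excludes it anyway.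
    have h := (hfin.subset (Set.sdiff_subset (t := {0}))).isClosed.isOpen_compl.mem_nhds
      (show (0 : ℂ) ∈ (spectrum ℂ (-A) \ {0})ᶜ by simp)
    filter_upwards [mem_nhdsWithin_of_mem_nhds h, self_mem_nhdsWithin] with ε h1 h2 h3
    exact h1 ⟨h3, h2⟩
  filter_upwards [this] with ε hε
  have := spectrum.notMem_iff.mp hε
  rwa [Algebra.algebraMap_eq_smul_one, sub_neg_eq_add, add_comm] at this

open Filter Topology in
-- Singular matrices are limits of the invertible `A l + ε • 1`, so restrictions of `T` are
-- degenerations of it.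
theorem matAct_mem_closure_glOrbit (A : ∀ l, Matrix (Fin (d l)) (Fin (d l)) ℂ) (T : KTensor d) :
    matAct A T ∈ closure T.glOrbit := by
  have hc : Continuous fun ε : ℂ => matAct (fun l => A l + ε • 1) T := by
    unfold matAct
    simp only [Matrix.add_apply, Matrix.smul_apply]
    fun_prop
  have ht : Tendsto (fun ε : ℂ => matAct (fun l => A l + ε • 1) T) (𝓝[≠] 0) (𝓝 (matAct A T)) := by
    have := (hc.tendsto 0).mono_left (nhdsWithin_le_nhds (s := {0}ᶜ))
    simpa using this
  refine mem_closure_of_tendsto ht ?_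
  filter_upwards [eventually_all.mpr fun l => eventually_isUnit_add_smul_one (A l)] with ε hε
  exact ⟨fun l => (hε l).unit, rfl⟩

theorem matAct_mem_closure_of_mem_closure (A : ∀ l, Matrix (Fin (d l)) (Fin (d l)) ℂ)
    {S T : KTensor d} (hS : S ∈ closure T.glOrbit) : matAct A S ∈ closure T.glOrbit := by
  have hmaps : Set.MapsTo (matAct A) T.glOrbit (closure T.glOrbit) := by
    rintro _ ⟨g, rfl⟩
    change matAct A (matAct (fun l => (g l : Matrix (Fin (d l)) (Fin (d l)) ℂ)) T) ∈ _
    rw [matAct_matAct]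
    exact matAct_mem_closure_glOrbit _ _
  have := map_mem_closure (continuous_matAct A) hS hmaps
  rwa [closure_closure] at this

end Action

/-! ### Gram matrices of flattenings -/

section Gram

variable {k : ℕ} {d : Fin k → ℕ}

/-- The Gram matrix `T_l^* T_l` of the `l`-th flattening. -/
noncomputable def gram (T : KTensor d) (l : Fin k) : Matrix (Fin (d l)) (Fin (d l)) ℂ :=
  (T.flatten l).conjTranspose * T.flatten l

theorem trace_gram (T : KTensor d) (l : Fin k) :
    (T.gram l).trace = ((∑ x, ‖T x‖ ^ 2 : ℝ) : ℂ) := by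
  rw [← (Equiv.piSplitAt l fun j => Fin (d j)).symm.sum_comp, Fintype.sum_prod_type]
  simp [gram, Matrix.trace, Matrix.mul_apply, flatten, Complex.conj_mul']

theorem sum_norm_sq_pos {T : KTensor d} (hT : T ≠ 0) : 0 < ∑ x, ‖T x‖ ^ 2 := by
  obtain ⟨x, hx⟩ := Function.ne_iff.mp hT
  exact Finset.sum_pos' (fun _ _ => by positivity)
    ⟨x, Finset.mem_univ x, pow_pos (norm_pos_iff.mpr hx) 2⟩

theorem marginal_eq (T : KTensor d) (l : Fin k) :
    T.marginal l = ((∑ x, ‖T x‖ ^ 2 : ℝ) : ℂ)⁻¹ • T.gram l := by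
  rw [← trace_gram T l]; rfl

theorem gram_eq {T : KTensor d} (hT : T ≠ 0) (l : Fin k) :
    T.gram l = ((∑ x, ‖T x‖ ^ 2 : ℝ) : ℂ) • T.marginal l := by
  rw [marginal_eq, smul_inv_smul₀]
  exact_mod_cast (sum_norm_sq_pos hT).ne'

theorem flatten_matAct (A : ∀ l, Matrix (Fin (d l)) (Fin (d l)) ℂ) (T : KTensor d) (l : Fin k) :
    (matAct A T).flatten l =
      (Matrix.of fun r s : (∀ j : {j // j ≠ l}, Fin (d j)) => ∏ j : {j // j ≠ l}, A j (r j) (s j)) *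
        T.flatten l * (A l).transpose := by
  ext r a
  simp only [flatten, matAct, Matrix.of_apply, Matrix.mul_apply, Matrix.transpose_apply]
  rw [← (Equiv.piSplitAt l fun j => Fin (d j)).symm.sum_comp, Fintype.sum_prod_type]
  refine Finset.sum_congr rfl fun b _ => ?_
  rw [Finset.sum_mul]
  refine Finset.sum_congr rfl fun s _ => ?_
  rw [Fintype.prod_eq_mul_prod_subtype_ne _ l]
  have : ∀ j : {j // j ≠ l}, A j ((Equiv.piSplitAt l fun j => Fin (d j)).symm (a, r) j)
      ((Equiv.piSplitAt l fun j => Fin (d j)).symm (b, s) j) = A j (r j) (s j) := by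
    intro j
    simp [Equiv.piSplitAt, j.2]
  rw [Finset.prod_congr rfl fun j _ => this j]
  simp only [Equiv.piSplitAt, Equiv.coe_fn_symm_mk, dite_true]
  ring

/-- The Kronecker product of the isometries on the other factors is an isometry and cancels from the
Gram matrix; only the action on factor `l` remains. -/
theorem gram_matAct_of_unitary {A : ∀ l, Matrix (Fin (d l)) (Fin (d l)) ℂ}
    (hA : ∀ l, (A l).conjTranspose * A l = 1) (T : KTensor d) (l : Fin k) :
    (matAct A T).gram l =
      (A l).transpose.conjTranspose * T.gram l * (A l).transpose := by
  have hK : (Matrix.of fun r s : (∀ j : {j // j ≠ l}, Fin (d j)) =>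
      ∏ j : {j // j ≠ l}, A j (r j) (s j)).conjTranspose *
      (Matrix.of fun r s : (∀ j : {j // j ≠ l}, Fin (d j)) => ∏ j : {j // j ≠ l}, A j (r j) (s j)) = 1 := by
    ext r s
    simp only [Matrix.mul_apply, Matrix.conjTranspose_apply, Matrix.of_apply, star_prod]
    have := sum_prod_mul_prod (fun j : {j // j ≠ l} => (A j).conjTranspose) (fun j => A j) r s
    simp only [Matrix.conjTranspose_apply] at this
    rw [this]
    simp_rw [hA, Matrix.one_apply]
    rw [Fintype.prod_ite_zero]
    simp [funext_iff]
  unfold gram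
  rw [flatten_matAct]
  simp only [Matrix.conjTranspose_mul, Matrix.mul_assoc]
  rw [← Matrix.mul_assoc _ _ (T.flatten l * _), hK, Matrix.one_mul]

/-- Every nonzero tensor can be rotated by local unitaries so that all its Gram matrices are
diagonal, with the spectra in non-increasing order on the diagonal. -/
theorem exists_matAct_gram_eq_diagonal {T : KTensor d} (hT : T ≠ 0) :
    ∃ (A : ∀ l, Matrix (Fin (d l)) (Fin (d l)) ℂ) (τ : ℝ), 0 < τ ∧
      ∀ l, (matAct A T).gram l =
        Matrix.diagonal fun i => ((τ * T.specMoment l i : ℝ) : ℂ) := by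
  choose U hU hUd using fun l =>
    exists_unitary_conj_eq_diagonal_hermitianSpec (T.marginal_isHermitian l)
  refine ⟨fun l => (U l).transpose, _, sum_norm_sq_pos hT, fun l => ?_⟩
  rw [gram_matAct_of_unitary, gram_eq hT, Matrix.transpose_transpose, Matrix.mul_smul,
    Matrix.smul_mul, hUd, ← Matrix.diagonal_smul]
  · congr 1; ext i; simp [specMoment]
  · intro l
    rw [Matrix.conjTranspose, Matrix.transpose_transpose]
    have := congrArg Matrix.transpose (mul_eq_one_comm.mp (hU l))
    rw [Matrix.transpose_mul, Matrix.transpose_one] at this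
    exact this

/-- Summing over full index tuples with one coordinate fixed avoids the dependent splitting in
`flatten`, which makes support arguments easy to apply. -/
theorem gram_apply (T : KTensor d) (l : Fin k) (a b : Fin (d l)) :
    T.gram l a b = ∑ x : (∀ j, Fin (d j)),
      if x l = b then star (T (Function.update x l a)) * T x else 0 := by
  rw [← (Equiv.piSplitAt l fun j => Fin (d j)).symm.sum_comp, Fintype.sum_prod_type]
  have h0 : ∀ (c : Fin (d l)) r, (Equiv.piSplitAt l fun j => Fin (d j)).symm (c, r) l = c := by
    simp [Equiv.piSplitAt]
  have h1 : ∀ (c e : Fin (d l)) r,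
      Function.update ((Equiv.piSplitAt l fun j => Fin (d j)).symm (c, r)) l e =
        (Equiv.piSplitAt l fun j => Fin (d j)).symm (e, r) := by
    intro c e r
    ext j
    by_cases h : j = l
    · subst h; simp [h0]
    · simp [Equiv.piSplitAt, h]
  simp only [h0, h1]
  rw [Finset.sum_eq_single b (by simp +contextual) (by simp)]
  simp [gram, Matrix.mul_apply, flatten]

end Gram

end KTensor

/-! ### Degenerate contractions of the iterated matrix multiplication tensor -/

/-- The tuple with entries `a`, `b`, `c` in the first three positions and those of `φ` elsewhere. -/
def withFirstThree {k : ℕ} {α : Type*} (a b c : α) (φ : Fin (k + 3) → α) : Fin (k + 3) → α :=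
  fun l => if l = 0 then a else if l = 1 then b else if l = 2 then c else φ l

section WithFirstThree

variable {k : ℕ} {α : Type*} (a b c : α) (φ : Fin (k + 3) → α)

theorem Fin.val_two_add_three : ((2 : Fin (k + 3)) : ℕ) = 2 := 
  Nat.mod_eq_of_lt (show 2 < k + 3 by omega)

theorem Fin.zero_ne_one_add_three : (0 : Fin (k + 3)) ≠ 1 := by simp

theorem Fin.zero_ne_two_add_three : (0 : Fin (k + 3)) ≠ 2 := by
  rw [Ne, Fin.ext_iff, Fin.val_two_add_three]; simp

theorem Fin.one_ne_two_add_three : (1 : Fin (k + 3)) ≠ 2 := by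
  rw [Ne, Fin.ext_iff, Fin.val_two_add_three]; simp

@[simp] theorem withFirstThree_zero : withFirstThree a b c φ 0 = a := by simp [withFirstThree]

@[simp] theorem withFirstThree_one : withFirstThree a b c φ 1 = b := by
  simp [withFirstThree, Fin.zero_ne_one_add_three.symm]

@[simp] theorem withFirstThree_two : withFirstThree a b c φ 2 = c := by
  simp [withFirstThree, Fin.zero_ne_two_add_three.symm, Fin.one_ne_two_add_three.symm]

theorem withFirstThree_of_ne {l : Fin (k + 3)} (h0 : l ≠ 0) (h1 : l ≠ 1) (h2 : l ≠ 2) :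
    withFirstThree a b c φ l = φ l := by simp [withFirstThree, h0, h1, h2]

end WithFirstThree

namespace KTensor

/-! ### Tensors as multilinear forms -/

section Eval

variable {k : ℕ} {d : Fin k → ℕ}

/-- The multilinear form with coefficients `T`. -/
def eval (T : KTensor d) (f : ∀ l, Fin (d l) → ℂ) : ℂ := ∑ x, (∏ l, f l (x l)) * T x

theorem eval_matAct (A : ∀ l, Matrix (Fin (d l)) (Fin (d l)) ℂ) (T : KTensor d)
    (f : ∀ l, Fin (d l) → ℂ) :
    (matAct A T).eval f = T.eval fun l => Matrix.vecMul (f l) (A l) := by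
  simp only [eval, matAct, Finset.mul_sum]
  rw [Finset.sum_comm]
  refine Finset.sum_congr rfl fun y _ => ?_
  simp only [Matrix.vecMul, dotProduct]
  rw [Fintype.prod_sum, Finset.sum_mul]
  refine Finset.sum_congr rfl fun x _ => ?_
  rw [Finset.prod_mul_distrib, mul_assoc]

theorem glAct_eq_matAct (g : ∀ l, GL (Fin (d l)) ℂ) (T : KTensor d) :
    glAct g T = matAct (fun l => (g l).1) T := rfl

theorem eval_smul (c : Fin k → ℂ) (T : KTensor d) (f : ∀ l, Fin (d l) → ℂ) :
    (T.eval fun l => c l • f l) = (∏ l, c l) * T.eval f := by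
  simp [eval, Finset.prod_mul_distrib, Finset.mul_sum, mul_assoc]

theorem eval_sum {ι : Type*} (s : Finset ι) (T : ι → KTensor d) (f : ∀ l, Fin (d l) → ℂ) :
    (∑ i ∈ s, T i).eval f = ∑ i ∈ s, (T i).eval f := by
  simp only [eval, Finset.sum_apply, Finset.mul_sum]
  exact Finset.sum_comm

theorem eval_pure (v f : ∀ l, Fin (d l) → ℂ) : (pure v).eval f = ∏ l, f l ⬝ᵥ v l := by
  simp only [eval, pure, ← Finset.prod_mul_distrib, dotProduct, Fintype.prod_sum]

theorem continuous_eval {X : Type*} [TopologicalSpace X] {T : X → KTensor d}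
    {f : X → ∀ l, Fin (d l) → ℂ} (hT : Continuous T) (hf : Continuous f) :
    Continuous fun p => (T p).eval (f p) := by
  unfold eval
  fun_prop

end Eval

end KTensor

/-- The position of the `(a, b)` entry in the row-wise flattening of an `n × n` matrix. -/
def matIdx {n : ℕ} (a b : Fin n) : Fin (n ^ 2) := Fin.cast (pow_two n).symm (finProdFinEquiv (a, b))

/-- The inverse of row-wise flattening. -/
def unflatten {n : ℕ} (f : Fin (n ^ 2) → ℂ) : Matrix (Fin n) (Fin n) ℂ :=
  Matrix.of fun a b => f (matIdx a b)

/-- Row-wise flattening of matrices. -/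
def flattenRows (n : ℕ) : Matrix (Fin n) (Fin n) ℂ →ₗ[ℂ] (Fin (n ^ 2) → ℂ) where
  toFun M x := M (finProdFinEquiv.symm (Fin.cast (pow_two n) x)).1
    (finProdFinEquiv.symm (Fin.cast (pow_two n) x)).2
  map_add' _ _ := rfl
  map_smul' _ _ := rfl

@[simp] theorem unflatten_flattenRows {n : ℕ} (M : Matrix (Fin n) (Fin n) ℂ) :
    unflatten (flattenRows n M) = M := by
  ext a b
  have : finProdFinEquiv.symm (Fin.cast (pow_two n) (matIdx a b)) = (a, b) :=
    finProdFinEquiv.symm_apply_apply (a, b)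
  change M (finProdFinEquiv.symm (Fin.cast (pow_two n) (matIdx a b))).1
    (finProdFinEquiv.symm (Fin.cast (pow_two n) (matIdx a b))).2 = M a b
  rw [this]

theorem eval_immTensor {n k : ℕ} (f : Fin k → Fin (n ^ 2) → ℂ) :
    (immTensor n k).eval f = ∑ i : Fin k → Fin n, ∏ l, unflatten (f l) (i l) (i (finRotate k l)) := by
  rw [immTensor, KTensor.eval_sum]
  refine Finset.sum_congr rfl fun i _ => ?_
  rw [KTensor.eval_pure]
  refine Finset.prod_congr rfl fun l _ => ?_
  simp [matUnitVec, unflatten, matIdx]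

/-- The summation index `i 1` occurs only in the factors `0` and `1`; summing over it first produces
an entry of the product of these two matrices. -/
theorem eval_immTensor_eq_zero {n k : ℕ} {f : Fin (k + 3) → Fin (n ^ 2) → ℂ}
    (h : unflatten (f 0) * unflatten (f 1) = 0) : (immTensor n (k + 3)).eval f = 0 := by
  rw [eval_immTensor, ← (Equiv.funSplitAt (1 : Fin (k + 3)) (Fin n)).symm.sum_comp,
    Fintype.sum_prod_type, Finset.sum_comm]
  refine Finset.sum_eq_zero fun r _ => ?_
  have h01 : (0 : Fin (k + 3)) ≠ 1 := Fin.zero_ne_one_add_three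
  have h21 : (2 : Fin (k + 3)) ≠ 1 := Fin.one_ne_two_add_three.symm
  have hone : ∀ b, (Equiv.funSplitAt (1 : Fin (k + 3)) (Fin n)).symm (b, r) 1 = b := by
    intro b; simp
  have hne : ∀ b (j : Fin (k + 3)) (hj : j ≠ 1),
      (Equiv.funSplitAt (1 : Fin (k + 3)) (Fin n)).symm (b, r) j = r ⟨j, hj⟩ := by
    intro b j hj; simp [hj]
  have hrot0 : finRotate (k + 3) 0 = 1 := by simp
  have hrot1 : finRotate (k + 3) 1 = 2 := by
    rw [finRotate_apply, Fin.ext_iff, Fin.val_two_add_three, Fin.val_add]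
    exact Nat.mod_eq_of_lt (by simp)
  have hrot : ∀ l, l ≠ 0 → finRotate (k + 3) l ≠ 1 := fun l hl h =>
    hl ((finRotate (k + 3)).injective (h.trans hrot0.symm))
  have hsplit : ∀ F : Fin (k + 3) → ℂ,
      ∏ l, F l = F 0 * F 1 * ∏ l ∈ (Finset.univ.erase 0).erase 1, F l := by
    intro F
    rw [mul_assoc, Finset.mul_prod_erase _ F (by simp [h01.symm]),
      Finset.mul_prod_erase _ F (by simp)]
  -- The part of the summand independent of `i 1`. The `attach` supplies the proofs that neither
  -- index of each remaining factor is at position `1`.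
  set R := ∏ l ∈ ((Finset.univ.erase 0).erase 1).attach,
    unflatten (f l.1) (r ⟨l.1, Finset.ne_of_mem_erase l.2⟩)
      (r ⟨finRotate (k + 3) l.1, hrot _ (Finset.ne_of_mem_erase (Finset.mem_of_mem_erase l.2))⟩)
    with hR
  have hterm : ∀ b, ∏ l, unflatten (f l)
      ((Equiv.funSplitAt (1 : Fin (k + 3)) (Fin n)).symm (b, r) l)
      ((Equiv.funSplitAt (1 : Fin (k + 3)) (Fin n)).symm (b, r) (finRotate (k + 3) l)) =
      (unflatten (f 0) (r ⟨0, h01⟩) b * unflatten (f 1) b (r ⟨2, h21⟩)) * R := by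
    intro b
    rw [hsplit, hrot0, hrot1, hone, hne b 0 h01, hne b 2 h21, hR, ← Finset.prod_attach]
    congr 1
    refine Finset.prod_congr rfl fun l _ => ?_
    rw [hne, hne]
  simp_rw [hterm]
  rw [← Finset.sum_mul, ← Matrix.mul_apply, h, Matrix.zero_apply, zero_mul]

/-- Either `F` is singular, or an eigenvector of `F⁻¹ G` with eigenvalue `c` lies in the kernel of
`G - c F`. This uses that `ℂ` is algebraically closed. -/
theorem exists_mulVec_pencil_eq_zero {n : ℕ} (hn : 0 < n) (F G : Matrix (Fin n) (Fin n) ℂ) :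
    ∃ s : ℂ × ℂ, s ≠ 0 ∧ ∃ h : Fin n → ℂ, h ≠ 0 ∧ (s.1 • F + s.2 • G).mulVec h = 0 := by
  by_cases hF : IsUnit F.det
  · have : Nonempty (Fin n) := ⟨⟨0, hn⟩⟩
    obtain ⟨c, hc⟩ := Module.End.exists_eigenvalue (Matrix.toLin' (F⁻¹ * G))
    obtain ⟨h, hh⟩ := hc.exists_hasEigenvector
    refine ⟨(-c, 1), by simp, h, hh.2, ?_⟩
    have h1 : (F⁻¹ * G).mulVec h = c • h := by simpa using hh.apply_eq_smul
    have h2 := congrArg F.mulVec h1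
    rw [Matrix.mulVec_mulVec, ← Matrix.mul_assoc, Matrix.mul_nonsing_inv _ hF, Matrix.one_mul,
      Matrix.mulVec_smul] at h2
    simp [Matrix.add_mulVec, Matrix.neg_mulVec, Matrix.smul_mulVec, h2]
  · have : F.det = 0 := by simpa using hF
    obtain ⟨h, h0, hh⟩ := Matrix.exists_mulVec_eq_zero_iff.mpr this
    exact ⟨(1, 0), by simp, h, h0, by simpa using hh⟩

/-- In the space spanned by two contractions of the iterated matrix multiplication tensor to a
bilinear form there is a nonzero one with a left kernel that is large enough to meet every subspace
of codimension less than `n`. -/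
theorem exists_eval_immTensor_eq_zero {n k q : ℕ} (hq : q < n) (u v : Fin (n ^ 2) → ℂ)
    (Q : (Fin (n ^ 2) → ℂ) →ₗ[ℂ] (Fin q → ℂ)) :
    ∃ s : ℂ × ℂ, s ≠ 0 ∧ ∃ w, w ≠ 0 ∧ Q w = 0 ∧ ∀ z φ,
      (immTensor n (k + 3)).eval (withFirstThree (s.1 • u + s.2 • v) w z φ) = 0 := by
  obtain ⟨s, hs, h, hh, hker⟩ :=
    exists_mulVec_pencil_eq_zero (by omega) (unflatten u) (unflatten v)
  -- The matrices `h yᵀ` are all killed by the singular pencil member. They depend on `n` parameters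
  -- `y`, more than the `q` equations imposed by `Q`.
  let E : (Fin n → ℂ) →ₗ[ℂ] (Fin (n ^ 2) → ℂ) :=
    flattenRows n ∘ₗ
      { toFun := fun y => Matrix.vecMulVec h y
        map_add' := fun y y' => Matrix.vecMulVec_add h y y'
        map_smul' := fun c y => Matrix.vecMulVec_smul c h y }
  have hne : LinearMap.ker (Q ∘ₗ E) ≠ ⊥ :=
    LinearMap.ker_ne_bot_of_finrank_lt (by simpa using hq)
  obtain ⟨y, hy, hy0⟩ := (Submodule.ne_bot_iff _).mp hne
  have hE : unflatten (E y) = Matrix.vecMulVec h y :=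
    unflatten_flattenRows (Matrix.vecMulVec h y)
  refine ⟨s, hs, E y, ?_, hy, fun z φ => eval_immTensor_eq_zero ?_⟩
  · intro h0
    rw [h0] at hE
    have : Matrix.vecMulVec h y = 0 := by rw [← hE]; rfl
    rcases Matrix.vecMulVec_eq_zero.mp this with h' | h'
    exacts [hh h', hy0 h']
  · rw [withFirstThree_zero, withFirstThree_one, hE, Matrix.mul_vecMulVec]
    have : unflatten (s.1 • u + s.2 • v) = s.1 • unflatten u + s.2 • unflatten v := rfl
    rw [this, hker, Matrix.zero_vecMulVec]

/-- The property quantifies over all `u`, `v`, `Q`, so it is invariant under the group: `u` and `v`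
are transported by `g 0`, and `Q` by the inverse of `g 1`. -/
theorem exists_eval_eq_zero_of_mem_glOrbit {n k q : ℕ} (hq : q < n)
    {T : KTensor fun _ : Fin (k + 3) => n ^ 2} (hT : T ∈ (immTensor n (k + 3)).glOrbit)
    (u v : Fin (n ^ 2) → ℂ) (Q : (Fin (n ^ 2) → ℂ) →ₗ[ℂ] (Fin q → ℂ)) :
    ∃ s : ℂ × ℂ, s ≠ 0 ∧ ∃ w, w ≠ 0 ∧ Q w = 0 ∧ ∀ z φ,
      T.eval (withFirstThree (s.1 • u + s.2 • v) w z φ) = 0 := by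
  obtain ⟨g, rfl⟩ := hT
  obtain ⟨s, hs, w, hw, hQ, hz⟩ := exists_eval_immTensor_eq_zero (k := k) hq
    (Matrix.vecMul u (g 0).1) (Matrix.vecMul v (g 0).1)
    (Q ∘ₗ Matrix.vecMulLinear (g 1)⁻¹.1)
  refine ⟨s, hs, Matrix.vecMul w (g 1)⁻¹.1, ?_, hQ, fun z φ => ?_⟩
  · intro h0
    apply hw
    have := congrArg (fun x => Matrix.vecMul x (g 1).1) h0
    simpa [Matrix.vecMul_vecMul, ← Units.val_mul] using this
  · beta_reduce
    rw [KTensor.glAct_eq_matAct, KTensor.eval_matAct, ← hz (Matrix.vecMul z (g 2).1) fun l => Matrix.vecMul (φ l) (g l).1]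
    congr 1
    funext l
    by_cases h0 : l = 0
    · subst h0; simp [Matrix.add_vecMul, Matrix.smul_vecMul]
    by_cases h1 : l = 1
    · subst h1; simp [Matrix.vecMul_vecMul]
    by_cases h2 : l = 2
    · subst h2; simp
    simp [withFirstThree_of_ne _ _ _ _ h0 h1 h2]

open Metric in
-- The conditions are homogeneous in `s` and in `w`, so both may be taken on unit spheres. The set
-- is then the projection of a closed set along a compact factor.
theorem isClosed_setOf_exists_eval_eq_zero {N k q : ℕ} (u v : Fin N → ℂ)
    (Q : (Fin N → ℂ) →ₗ[ℂ] (Fin q → ℂ)) :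
    IsClosed {T : KTensor fun _ : Fin (k + 3) => N |
      ∃ s : ℂ × ℂ, s ≠ 0 ∧ ∃ w, w ≠ 0 ∧ Q w = 0 ∧ ∀ z φ,
        T.eval (withFirstThree (s.1 • u + s.2 • v) w z φ) = 0} := by
  let K : Set ((ℂ × ℂ) × (Fin N → ℂ)) := sphere 0 1 ×ˢ sphere 0 1
  have hK : IsCompact K := (isCompact_sphere _ _).prod (isCompact_sphere _ _)
  have : CompactSpace K := isCompact_iff_compactSpace.mp hK
  let Z : Set ((KTensor fun _ : Fin (k + 3) => N) × K) :=
    {p | Q p.2.1.2 = 0} ∩ ⋂ z, ⋂ φ,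
      {p | p.1.eval (withFirstThree (p.2.1.1.1 • u + p.2.1.1.2 • v) p.2.1.2 z φ) = 0}
  have hQc : Continuous fun p : (KTensor fun _ : Fin (k + 3) => N) × K => Q p.2.1.2 :=
    (LinearMap.continuous_of_finiteDimensional Q).comp (by fun_prop)
  have hec : ∀ z φ, Continuous fun p : (KTensor fun _ : Fin (k + 3) => N) × K =>
      p.1.eval (withFirstThree (p.2.1.1.1 • u + p.2.1.1.2 • v) p.2.1.2 z φ) := by
    intro z φ
    have hf : Continuous fun p : (KTensor fun _ : Fin (k + 3) => N) × K =>
        withFirstThree (p.2.1.1.1 • u + p.2.1.1.2 • v) p.2.1.2 z φ := by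
      refine continuous_pi fun l => ?_
      unfold withFirstThree
      split_ifs <;> fun_prop
    exact KTensor.continuous_eval (d := fun _ : Fin (k + 3) => N) continuous_fst hf
  have hZ : IsClosed Z :=
    (isClosed_eq hQc continuous_const).inter
      (isClosed_iInter fun z => isClosed_iInter fun φ => isClosed_eq (hec z φ) continuous_const)
  convert isClosedMap_fst_of_compactSpace _ hZ using 1
  ext T
  constructor
  · rintro ⟨s, hs, w, hw, hQ, hz⟩
    have hs' : ‖s‖ ≠ 0 := norm_ne_zero_iff.mpr hs
    have hw' : ‖w‖ ≠ 0 := norm_ne_zero_iff.mpr hw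
    refine ⟨(T, ⟨(((‖s‖ : ℂ)⁻¹ • s), ((‖w‖ : ℂ)⁻¹ • w)), ?_, ?_⟩),
      ⟨?_, Set.mem_iInter₂.mpr fun z φ => ?_⟩, rfl⟩
    · simp [norm_smul, hs']
    · simp [norm_smul, hw']
    · simp [hQ]
    · rw [Set.mem_ofPred_eq]
      -- Normalizing `s` and `w` rescales the arguments in positions `0` and `1`, hence multiplies
      -- the form by a scalar.
      have h : withFirstThree (((‖s‖ : ℂ)⁻¹ • s).1 • u + ((‖s‖ : ℂ)⁻¹ • s).2 • v)
          ((‖w‖ : ℂ)⁻¹ • w) z φ = fun l =>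
            withFirstThree (‖s‖ : ℂ)⁻¹ (‖w‖ : ℂ)⁻¹ 1 1 l •
              withFirstThree (s.1 • u + s.2 • v) w z φ l := by
        funext l
        unfold withFirstThree
        split_ifs <;> simp [mul_smul]
      simp only [h]
      rw [KTensor.eval_smul, hz, mul_zero]
  · rintro ⟨⟨S, ⟨⟨s, w⟩, hs, hw⟩⟩, ⟨hQ, hz⟩, rfl⟩
    exact ⟨s, ne_zero_of_mem_unit_sphere ⟨s, hs⟩, w, ne_zero_of_mem_unit_sphere ⟨w, hw⟩, hQ,
      fun z φ => Set.mem_iInter₂.mp hz z φ⟩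

theorem exists_eval_eq_zero_of_mem_closure {n k q : ℕ} (hq : q < n)
    {T : KTensor fun _ : Fin (k + 3) => n ^ 2} (hT : T ∈ closure (immTensor n (k + 3)).glOrbit)
    (u v : Fin (n ^ 2) → ℂ) (Q : (Fin (n ^ 2) → ℂ) →ₗ[ℂ] (Fin q → ℂ)) :
    ∃ s : ℂ × ℂ, s ≠ 0 ∧ ∃ w, w ≠ 0 ∧ Q w = 0 ∧ ∀ z φ,
      T.eval (withFirstThree (s.1 • u + s.2 • v) w z φ) = 0 :=
  closure_minimal (fun _ hS => exists_eval_eq_zero_of_mem_glOrbit hq hS u v Q)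
    (isClosed_setOf_exists_eval_eq_zero u v Q) hT

/-! ### Tensors supported on the first three factors -/

section SumWithFirstThree

variable {k : ℕ} {α M : Type*} [CommMonoid M]

theorem prod_withFirstThree_one (a b c : M) :
    ∏ l : Fin (k + 3), withFirstThree a b c (fun _ => 1) l = a * b * c := by
  rw [← Finset.prod_subset (Finset.subset_univ ({0, 1, 2} : Finset (Fin (k + 3))))]
  · rw [Finset.prod_insert, Finset.prod_insert, Finset.prod_singleton]
    · simp [mul_assoc]
    · simpa using Fin.one_ne_two_add_three
    · simpa using Fin.zero_ne_two_add_three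
  · intro l _ hl
    simp only [Finset.mem_insert, Finset.mem_singleton, not_or] at hl
    exact withFirstThree_of_ne _ _ _ _ hl.1 hl.2.1 hl.2.2

/-- Reduces order `k + 3` to order three when the summand forces all later coordinates to be `o`. -/
theorem sum_eq_sum_withFirstThree {A : Type*} [AddCommMonoid A] [Fintype α] (o : α)
    {F : (Fin (k + 3) → α) → A}
    (hF : ∀ x l, l ≠ 0 → l ≠ 1 → l ≠ 2 → x l ≠ o → F x = 0) :
    ∑ x, F x = ∑ a, ∑ b, ∑ c, F (withFirstThree a b c fun _ => o) := by
  simp_rw [← Fintype.sum_prod_type']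
  symm
  refine Fintype.sum_of_injective
    (fun p : α × α × α => withFirstThree p.1 p.2.1 p.2.2 fun _ => o) ?_ _ _ ?_ fun _ => rfl
  · intro p q h
    have h0 := congrFun h 0
    have h1 := congrFun h 1
    have h2 := congrFun h 2
    simp only [withFirstThree_zero, withFirstThree_one, withFirstThree_two] at h0 h1 h2
    exact Prod.ext h0 (Prod.ext h1 h2)
  · intro x hx
    by_contra h
    refine hx ⟨(x 0, x 1, x 2), funext fun l => ?_⟩
    by_cases h0 : l = 0
    · subst h0; simp
    by_cases h1 : l = 1
    · subst h1; simp
    by_cases h2 : l = 2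
    · subst h2; simp
    refine (withFirstThree_of_ne _ _ _ _ h0 h1 h2).trans ?_
    by_contra hne
    exact h (hF x l h0 h1 h2 (Ne.symm hne))

variable (a b c e : α) (φ : Fin (k + 3) → α)

theorem update_withFirstThree_zero :
    Function.update (withFirstThree a b c φ) 0 e = withFirstThree e b c φ := by
  funext l
  by_cases h : l = 0
  · subst h; simp
  · simp [withFirstThree, h]

theorem update_withFirstThree_one :
    Function.update (withFirstThree a b c φ) 1 e = withFirstThree a e c φ := by
  funext l
  by_cases h : l = 1
  · subst h; simp
  · simp [withFirstThree, h]

theorem update_withFirstThree_two :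
    Function.update (withFirstThree a b c φ) 2 e = withFirstThree a b e φ := by
  funext l
  by_cases h : l = 2
  · subst h; simp
  · simp [withFirstThree, h]

end SumWithFirstThree

namespace KTensor

section

variable {k N : ℕ} {T : KTensor fun _ : Fin (k + 3) => N} {o : Fin N}

/-- All factors of `T` from the fourth one on are multiples of the basis vector `e_o`. -/
def IsOrderThree (T : KTensor fun _ : Fin (k + 3) => N) (o : Fin N) : Prop :=
  ∀ x l, l ≠ 0 → l ≠ 1 → l ≠ 2 → x l ≠ o → T x = 0

/-- The entry of `T` at a position whose coordinates from the fourth one on are `o`. -/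
def entry (T : KTensor fun _ : Fin (k + 3) => N) (o a b c : Fin N) : ℂ :=
  T (withFirstThree a b c fun _ => o)

theorem IsOrderThree.gram_zero (hT : T.IsOrderThree o) (a a' : Fin N) :
    T.gram 0 a a' = ∑ b, ∑ c, star (T.entry o a b c) * T.entry o a' b c := by
  rw [gram_apply, sum_eq_sum_withFirstThree o
    (fun x l h0 h1 h2 h => by simp [hT x l h0 h1 h2 h])]
  simp only [withFirstThree_zero, update_withFirstThree_zero]
  rw [Finset.sum_eq_single a' (by simp +contextual) (by simp)]
  simp [entry]

theorem IsOrderThree.gram_one (hT : T.IsOrderThree o) (b b' : Fin N) :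
    T.gram 1 b b' = ∑ a, ∑ c, star (T.entry o a b c) * T.entry o a b' c := by
  rw [gram_apply, sum_eq_sum_withFirstThree o
    (fun x l h0 h1 h2 h => by simp [hT x l h0 h1 h2 h])]
  simp only [withFirstThree_one, update_withFirstThree_one]
  refine Finset.sum_congr rfl fun a _ => ?_
  rw [Finset.sum_eq_single b' (by simp +contextual) (by simp)]
  simp [entry]

theorem IsOrderThree.gram_two (hT : T.IsOrderThree o) (c c' : Fin N) :
    T.gram 2 c c' = ∑ a, ∑ b, star (T.entry o a b c) * T.entry o a b c' := by
  rw [gram_apply, sum_eq_sum_withFirstThree o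
    (fun x l h0 h1 h2 h => by simp [hT x l h0 h1 h2 h])]
  simp only [withFirstThree_two, update_withFirstThree_two]
  refine Finset.sum_congr rfl fun a _ => Finset.sum_congr rfl fun b _ => ?_
  rw [Finset.sum_eq_single c' (by simp +contextual) (by simp)]
  simp [entry]

theorem IsOrderThree.gram_of_ne (hT : T.IsOrderThree o) {l : Fin (k + 3)} (h0 : l ≠ 0)
    (h1 : l ≠ 1) (h2 : l ≠ 2) :
    T.gram l = Matrix.diagonal fun i => if i = o then ((∑ x, ‖T x‖ ^ 2 : ℝ) : ℂ) else 0 := by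
  ext a b
  rw [gram_apply]
  by_cases hb : b = o
  · by_cases ha : a = o
    · subst ha
      subst hb
      rw [Matrix.diagonal_apply_eq, if_pos rfl, Complex.ofReal_sum]
      refine Finset.sum_congr rfl fun x _ => ?_
      split_ifs with hx
      · conv_lhs => rw [← hx, Function.update_eq_self]
        simp [Complex.conj_mul']
      · simp [hT x l h0 h1 h2 hx]
    · rw [Matrix.diagonal_apply_ne _ (by rw [hb]; exact ha)]
      refine Finset.sum_eq_zero fun x _ => ?_
      rw [hT (Function.update x l a) l h0 h1 h2 (by simpa using ha)]
      simp
  · have : Matrix.diagonal (fun i => if i = o then ((∑ x, ‖T x‖ ^ 2 : ℝ) : ℂ) else 0) a b = 0 := by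
      rw [Matrix.diagonal_apply]
      split_ifs with h h' <;> simp_all
    rw [this]
    refine Finset.sum_eq_zero fun x _ => ?_
    split_ifs with hx
    · rw [hT x l h0 h1 h2 (by rwa [hx]), mul_zero]
    · rfl

theorem IsOrderThree.eval_withFirstThree (hT : T.IsOrderThree o) (u w z : Fin N → ℂ) :
    T.eval (withFirstThree u w z fun _ => Pi.single o 1) =
      ∑ a, ∑ b, ∑ c, u a * w b * z c * T.entry o a b c := by
  rw [eval, sum_eq_sum_withFirstThree o
    (fun x l h0 h1 h2 h => by rw [hT x l h0 h1 h2 h, mul_zero])]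
  refine Finset.sum_congr rfl fun a _ => Finset.sum_congr rfl fun b _ =>
    Finset.sum_congr rfl fun c _ => ?_
  rw [entry, ← prod_withFirstThree_one (k := k) (u a) (w b) (z c)]
  congr 1
  refine Finset.prod_congr rfl fun l _ => ?_
  unfold withFirstThree
  split_ifs <;> simp

end

/-- A diagonal Gram entry is the squared norm of the corresponding slice. -/
theorem eq_zero_of_gram_apply_self_eq_zero {k : ℕ} {d : Fin k → ℕ} {T : KTensor d} {l : Fin k}
    {i : Fin (d l)} (h : T.gram l i i = 0) {x : ∀ l, Fin (d l)} (hx : x l = i) : T x = 0 := by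
  have h1 : T.gram l i i = ((∑ x, (if x l = i then ‖T x‖ ^ 2 else 0 : ℝ) : ℝ) : ℂ) := by
    rw [gram_apply, Complex.ofReal_sum]
    refine Finset.sum_congr rfl fun y _ => ?_
    split_ifs with hy
    · conv_lhs => rw [← hy, Function.update_eq_self]
      simp [Complex.conj_mul']
    · simp
  rw [h1, Complex.ofReal_eq_zero, Finset.sum_eq_zero_iff_of_nonneg
    (fun y _ => by split_ifs <;> positivity)] at h
  simpa [hx] using h x (Finset.mem_univ x)

end KTensor

/-! ### An obstruction to uniform marginals -/

theorem sum_norm_sq_mulVec_of_gram_eq_diagonal {ι κ : Type*} [Fintype ι] [Fintype κ]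
    [DecidableEq κ] {M : Matrix ι κ ℂ} {q : κ → ℝ}
    (hM : M.conjTranspose * M = Matrix.diagonal fun j => (q j : ℂ)) (w : κ → ℂ) :
    ∑ i, ‖M.mulVec w i‖ ^ 2 = ∑ j, q j * ‖w j‖ ^ 2 := by
  have h : star (M.mulVec w) ⬝ᵥ M.mulVec w = star w ⬝ᵥ (M.conjTranspose * M).mulVec w := by
    rw [Matrix.star_mulVec, ← Matrix.dotProduct_mulVec, Matrix.mulVec_mulVec]
  rw [hM] at h
  have h' : ((∑ i, ‖M.mulVec w i‖ ^ 2 : ℝ) : ℂ) = ((∑ j, q j * ‖w j‖ ^ 2 : ℝ) : ℂ) := by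
    have hl : star (M.mulVec w) ⬝ᵥ M.mulVec w = ((∑ i, ‖M.mulVec w i‖ ^ 2 : ℝ) : ℂ) := by
      simp [dotProduct, Complex.conj_mul']
    rw [← hl, h]
    simp only [dotProduct, Matrix.mulVec_diagonal, Pi.star_apply, Complex.ofReal_sum]
    refine Finset.sum_congr rfl fun j _ => ?_
    rw [mul_left_comm, RCLike.star_def, Complex.conj_mul']
    push_cast
    rfl
  exact_mod_cast h'

/-- A pair of matrices `A 0, A 1` that is uniform in the row space and bounded in the column space
has no singular linear combination, in the sense that the left kernels do not meet the space on
which it is uniform. -/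
theorem pencil_vecMul_ne_zero {ι κ : Type*} [Fintype ι] [Fintype κ] [DecidableEq ι]
    [DecidableEq κ] {A : Fin 2 → Matrix ι κ ℂ} {p : ι → ℝ} {q : κ → ℝ} {α β : ℝ} (hα : 0 < α)
    (hβα : β < α)
    (hrow : (Matrix.of fun (i : Fin 2 × κ) b => A i.1 b i.2).conjTranspose *
      (Matrix.of fun (i : Fin 2 × κ) b => A i.1 b i.2) = Matrix.diagonal fun b => (p b : ℂ))
    (hcol : (Matrix.of fun (i : Fin 2 × ι) c => A i.1 i.2 c).conjTranspose *
      (Matrix.of fun (i : Fin 2 × ι) c => A i.1 i.2 c) = Matrix.diagonal fun c => (q c : ℂ))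
    (hq : ∀ c, q c ≤ β) {w : ι → ℂ} (hw : w ≠ 0) (hp : ∀ b, w b ≠ 0 → p b = α)
    {s : ℂ × ℂ} (hs : s ≠ 0) :
    s.1 • Matrix.vecMul w (A 0) + s.2 • Matrix.vecMul w (A 1) ≠ 0 := by
  intro h
  set D : ℝ := ‖s.1‖ ^ 2 + ‖s.2‖ ^ 2 with hD
  have hDpos : 0 < D := by
    rcases not_and_or.mp (fun hh : s.1 = 0 ∧ s.2 = 0 => hs (Prod.ext hh.1 hh.2)) with h1 | h1
    · have := norm_pos_iff.mpr h1; positivity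
    · have := norm_pos_iff.mpr h1; positivity
  set W : ℝ := ∑ b, ‖w b‖ ^ 2 with hW
  have hWpos : 0 < W := by
    obtain ⟨b, hb⟩ := Function.ne_iff.mp hw
    exact Finset.sum_pos' (fun _ _ => by positivity)
      ⟨b, Finset.mem_univ b, pow_pos (norm_pos_iff.mpr hb) 2⟩
  -- Contraction of the two rows with `(-s̄₂, s̄₁)`, the direction complementary to the vanishing
  -- combination. It captures their entire mass up to the factor `D`.
  let ρ : κ → ℂ := fun c =>
    -star s.2 * Matrix.vecMul w (A 0) c + star s.1 * Matrix.vecMul w (A 1) c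
  set R : ℝ := ∑ c, ‖ρ c‖ ^ 2 with hR
  have hsum := sum_norm_sq_mulVec_of_gram_eq_diagonal hrow w
  rw [Fintype.sum_prod_type, Fin.sum_univ_two, ← Finset.sum_add_distrib] at hsum
  have hrowval : ∀ (i : Fin 2) c, (Matrix.of fun (i : Fin 2 × κ) b => A i.1 b i.2).mulVec w (i, c) =
      Matrix.vecMul w (A i) c := by
    intro i c
    simp [Matrix.mulVec, Matrix.vecMul, dotProduct, mul_comm]
  simp only [hrowval] at hsum
  -- Lagrange's identity, in which the term of the vanishing combination drops out.
  have hlag : ∀ c, ‖ρ c‖ ^ 2 =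
      D * (‖Matrix.vecMul w (A 0) c‖ ^ 2 + ‖Matrix.vecMul w (A 1) c‖ ^ 2) := by
    intro c
    have hc : s.1 * Matrix.vecMul w (A 0) c + s.2 * Matrix.vecMul w (A 1) c = 0 := congrFun h c
    have hc' := congrArg star hc
    simp only [star_add, star_mul', star_zero] at hc'
    apply Complex.ofReal_injective
    rw [hD]
    push_cast
    simp only [← Complex.conj_mul', ← Complex.star_def, ρ, star_add, star_mul', star_neg, star_star]
    linear_combination -(star s.1 * star (Matrix.vecMul w (A 0) c) +
      star s.2 * star (Matrix.vecMul w (A 1) c)) * hc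
  have hRval : R = D * (α * W) := by
    have hRD : R = D * ∑ c, (‖Matrix.vecMul w (A 0) c‖ ^ 2 + ‖Matrix.vecMul w (A 1) c‖ ^ 2) := by
      rw [Finset.mul_sum]
      exact Finset.sum_congr rfl fun c _ => hlag c
    rw [hRD, hsum, hW, Finset.mul_sum _ _ α]
    congr 1
    refine Finset.sum_congr rfl fun b _ => ?_
    by_cases hb : w b = 0
    · simp [hb]
    · rw [hp b hb]
  let z : κ → ℂ := fun c => star (ρ c)
  have hcolsum := sum_norm_sq_mulVec_of_gram_eq_diagonal hcol z
  have hcolle : ∑ i : Fin 2 × ι, ‖(A i.1).mulVec z i.2‖ ^ 2 ≤ β * R := by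
    change ∑ i : Fin 2 × ι, ‖(A i.1).mulVec z i.2‖ ^ 2 = _ at hcolsum
    rw [hcolsum, hR, Finset.mul_sum]
    refine Finset.sum_le_sum fun c _ => ?_
    simp only [z, norm_star]
    exact mul_le_mul_of_nonneg_right (hq c) (by positivity)
  let v : Fin 2 × ι → ℂ := fun i => (if i.1 = 0 then -star s.2 else star s.1) * w i.2
  have hv : ∑ i, ‖v i‖ ^ 2 = D * W := by
    rw [Fintype.sum_prod_type, Fin.sum_univ_two]
    simp only [v, norm_mul, mul_pow, if_true, one_ne_zero, if_false, norm_neg, norm_star,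
      ← Finset.mul_sum, ← hW, hD]
    ring
  -- `R` is the pencil evaluated at `v`, the tensor product of `(-s̄₂, s̄₁)` and `w`, and at `z`,
  -- the conjugate of `ρ`. Cauchy–Schwarz and the column bound give `R² ≤ D W β R`, whereas
  -- uniformity on the support of `w` gives `R = D α W`.
  have hRv : ((R : ℝ) : ℂ) = ∑ i : Fin 2 × ι, v i * (A i.1).mulVec z i.2 := by
    have h1 : ((R : ℝ) : ℂ) = ρ ⬝ᵥ z := by
      simp [hR, z, dotProduct, Complex.mul_conj']
    have h2 : ρ = -star s.2 • Matrix.vecMul w (A 0) + star s.1 • Matrix.vecMul w (A 1) := rfl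
    rw [h1, h2, add_dotProduct, smul_dotProduct, smul_dotProduct, ← Matrix.dotProduct_mulVec,
      ← Matrix.dotProduct_mulVec, Fintype.sum_prod_type, Fin.sum_univ_two]
    simp [v, dotProduct, Finset.mul_sum, mul_assoc]
  have hCS : R ^ 2 ≤ (D * W) * (β * R) := by
    have h1 : R ≤ ∑ i : Fin 2 × ι, ‖v i‖ * ‖(A i.1).mulVec z i.2‖ := by
      calc R ≤ ‖((R : ℝ) : ℂ)‖ := by rw [Complex.norm_real]; exact le_abs_self R
        _ ≤ _ := by
          rw [hRv]
          refine (norm_sum_le _ _).trans_eq ?_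
          simp
    have hR0 : 0 ≤ R := Finset.sum_nonneg fun _ _ => by positivity
    calc R ^ 2 ≤ (∑ i : Fin 2 × ι, ‖v i‖ * ‖(A i.1).mulVec z i.2‖) ^ 2 := by gcongr
      _ ≤ (∑ i, ‖v i‖ ^ 2) * ∑ i : Fin 2 × ι, ‖(A i.1).mulVec z i.2‖ ^ 2 :=
        Finset.sum_mul_sq_le_sq_mul_sq _ _ _
      _ ≤ _ := by
        rw [hv]
        exact mul_le_mul_of_nonneg_left hcolle (by positivity)
  have hRpos : 0 < R := hRval ▸ by positivity
  have h1 : R ≤ D * W * β := by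
    refine le_of_mul_le_mul_right ?_ hRpos
    linarith
  have h2 : D * W * β < D * W * α := mul_lt_mul_of_pos_left hβα (by positivity)
  linarith

/-- The uniform probability vector on the first `r` coordinates. -/
noncomputable def uniformVec (r m : ℕ) (i : Fin m) : ℝ := if (i : ℕ) < r then (r : ℝ)⁻¹ else 0

theorem antitone_uniformVec (r m : ℕ) : Antitone (uniformVec r m) := by
  intro i j hij
  unfold uniformVec
  have : (i : ℕ) ≤ j := hij
  split_ifs
  · exact le_rfl
  · omega
  · positivity
  · exact le_rfl

/-- The marginal ranks of the generic tensor in `ℂ² ⊗ ℂᵐ ⊗ ℂᵐ⁺¹ ⊗ ℂ ⊗ ⋯ ⊗ ℂ`. -/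
def pencilRanks (k m : ℕ) : Fin (k + 3) → ℕ := withFirstThree 2 m (m + 1) fun _ => 1

namespace KTensor

/-- The zero Gram entries confine `T` to a pencil `A 0, A 1` of two slices, and `u`, `v` are the
basis vectors selecting these. A vanishing contraction would make some combination of the slices
kill `w`. -/
theorem eval_ne_zero_of_uniform_gram {k N m : ℕ} (hm : 0 < m) (hmN : m + 1 ≤ N)
    {T : KTensor fun _ : Fin (k + 3) => N} {τ : ℝ} (hτ : 0 < τ)
    (hT : ∀ l, T.gram l =
      Matrix.diagonal fun i => ((τ * uniformVec (pencilRanks k m l) N i : ℝ) : ℂ)) :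
    ∃ u v : Fin N → ℂ, ∀ s : ℂ × ℂ, s ≠ 0 → ∀ w : Fin N → ℂ, w ≠ 0 →
      (∀ b : Fin N, m ≤ (b : ℕ) → w b = 0) →
      ∃ z φ, T.eval (withFirstThree (s.1 • u + s.2 • v) w z φ) ≠ 0 := by
  let o : Fin N := ⟨0, by omega⟩
  let e : Fin N := ⟨1, by omega⟩
  have hoe : o ≠ e := by simp [o, e]
  have hzero : ∀ (l : Fin (k + 3)) (x : Fin (k + 3) → Fin N), pencilRanks k m l ≤ x l →
      T x = 0 := by
    intro l x hx
    refine eq_zero_of_gram_apply_self_eq_zero (l := l) (i := x l) ?_ rfl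
    rw [hT, Matrix.diagonal_apply_eq, uniformVec, if_neg (not_lt.mpr hx), mul_zero,
      Complex.ofReal_zero]
  have horder : T.IsOrderThree o := by
    intro x l h0 h1 h2 hx
    refine hzero l x ?_
    rw [pencilRanks, withFirstThree_of_ne _ _ _ _ h0 h1 h2]
    have : (x l : ℕ) ≠ 0 := fun h => hx (Fin.ext h)
    omega
  have hslice : ∀ a, a ≠ o ∧ a ≠ e → ∀ b c, T.entry o a b c = 0 := by
    intro a ha b c
    refine hzero 0 _ ?_
    rw [pencilRanks, withFirstThree_zero, withFirstThree_zero]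
    have h0 : (a : ℕ) ≠ 0 := fun h => ha.1 (Fin.ext h)
    have h1 : (a : ℕ) ≠ 1 := fun h => ha.2 (Fin.ext h)
    omega
  let A : Fin 2 → Matrix (Fin N) (Fin N) ℂ :=
    fun i => Matrix.of fun b c => T.entry o (if i = 0 then o else e) b c
  have hrow : (Matrix.of fun (i : Fin 2 × Fin N) b => A i.1 b i.2).conjTranspose *
      (Matrix.of fun (i : Fin 2 × Fin N) b => A i.1 b i.2) =
        Matrix.diagonal fun b => ((τ * uniformVec m N b : ℝ) : ℂ) := by
    have h := hT 1
    rw [pencilRanks, withFirstThree_one] at h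
    rw [← h]
    ext b b'
    rw [horder.gram_one, Fintype.sum_eq_add o e hoe fun a ha => by simp [hslice a ha]]
    simp [Matrix.mul_apply, Fintype.sum_prod_type, A]
  have hcol : (Matrix.of fun (i : Fin 2 × Fin N) c => A i.1 i.2 c).conjTranspose *
      (Matrix.of fun (i : Fin 2 × Fin N) c => A i.1 i.2 c) =
        Matrix.diagonal fun b => ((τ * uniformVec (m + 1) N b : ℝ) : ℂ) := by
    have h := hT 2
    rw [pencilRanks, withFirstThree_two] at h
    rw [← h]
    ext c c'
    rw [horder.gram_two, Fintype.sum_eq_add o e hoe fun a ha => by simp [hslice a ha]]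
    simp [Matrix.mul_apply, Fintype.sum_prod_type, A]
  refine ⟨Pi.single o 1, Pi.single e 1, fun s hs w hw hwm => ?_⟩
  have hm' : (0 : ℝ) < m := by exact_mod_cast hm
  -- The strict gap `1/(m + 1) < 1/m` between the marginals of the third and second factors drives
  -- the contradiction.
  have hne := pencil_vecMul_ne_zero (α := τ * (m : ℝ)⁻¹) (β := τ * ((m : ℝ) + 1)⁻¹)
    (by positivity)
    (mul_lt_mul_of_pos_left (inv_strictAnti₀ hm' (lt_add_one _)) hτ) hrow hcol ?_ hw ?_ hs
  · obtain ⟨c, hc⟩ := Function.ne_iff.mp hne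
    refine ⟨Pi.single c 1, fun _ => Pi.single o 1, ?_⟩
    rw [horder.eval_withFirstThree,
      Fintype.sum_eq_add o e hoe fun a ha => by simp [hslice a ha]]
    rw [Pi.zero_apply] at hc
    convert hc using 1
    simp [Pi.single_apply, hoe, hoe.symm, A, Matrix.vecMul, dotProduct, Finset.mul_sum, mul_assoc]
  · intro c
    refine mul_le_mul_of_nonneg_left ?_ hτ.le
    unfold uniformVec
    split_ifs
    · push_cast; exact le_rfl
    · positivity
  · intro b hb
    have : (b : ℕ) < m := by
      by_contra h
      exact hb (hwm b (not_lt.mp h))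
    rw [uniformVec, if_pos this]

end KTensor

/-- A point with the marginals of a generic matrix pencil of format `m × (m + 1)` is missing from
the moment polytope of iterated matrix multiplication if `m > n² - n`. -/
theorem uniformVec_notMem_momentPolytope_immTensor {k n m : ℕ} (hm : 0 < m) (hmn : m + 1 ≤ n ^ 2)
    (hlow : n ^ 2 - m < n) :
    (fun l => uniformVec (pencilRanks k m l) (n ^ 2)) ∉
      (immTensor n (k + 3)).momentPolytope := by
  rintro ⟨S, ⟨hS, hS0⟩, hspec⟩
  -- Spectra determine the marginals only up to local unitaries, which preserve the orbit closure.
  obtain ⟨A, τ, hτ, hgram⟩ := KTensor.exists_matAct_gram_eq_diagonal (T := S) hS0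
  rw [hspec] at hgram
  obtain ⟨u, v, hne⟩ := KTensor.eval_ne_zero_of_uniform_gram hm hmn hτ hgram
  obtain ⟨s, hs, w, hw, hQ, hz⟩ := exists_eval_eq_zero_of_mem_closure hlow
    (KTensor.matAct_mem_closure_of_mem_closure A hS) u v
    -- `Q` reads the last `n² - m` coordinates, so `Q w = 0` places `w` in the support of the second
    -- marginal.
    (LinearMap.funLeft ℂ ℂ fun i : Fin (n ^ 2 - m) => (⟨m + i, by omega⟩ : Fin (n ^ 2)))
  obtain ⟨z, φ, h⟩ := hne s hs w hw fun b hb => by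
    have := congrFun hQ ⟨b - m, by omega⟩
    simpa [LinearMap.funLeft_apply, Nat.add_sub_cancel' hb] using this
  exact h (hz z φ)

/-! ### Uniform marginals from polynomial multiplication -/

theorem matAct_unitTensor_apply {r k : ℕ} (A : Fin k → Matrix (Fin r) (Fin r) ℂ)
    (x : Fin k → Fin r) :
    KTensor.matAct A (unitTensor r k) x = ∑ j, ∏ l, A l (x l) j := by
  change (unitTensor r k).eval (fun l => A l (x l)) = _
  rw [unitTensor, KTensor.eval_sum]
  refine Finset.sum_congr rfl fun j _ => ?_
  rw [KTensor.eval_pure]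
  simp

/-- The squared coefficients of the `SL`-normalization of the tensor that multiplies polynomials of
degree at most `1` with polynomials of degree less than `m`. -/
def pencilWeight (m : ℕ) (a b c : Fin (m + 1)) : ℕ :=
  if (a : ℕ) = 0 ∧ (b : ℕ) < m ∧ (b : ℕ) = c then m - b
  else if (a : ℕ) = 1 ∧ (b : ℕ) < m ∧ (b : ℕ) + 1 = c then (b : ℕ) + 1 else 0

/-- Any two of the three indices determine the third on the support; this makes all the Gram
matrices diagonal. -/
theorem add_eq_of_pencilWeight_ne_zero {m : ℕ} {a b c : Fin (m + 1)}
    (h : pencilWeight m a b c ≠ 0) : (a : ℕ) + b = c := by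
  unfold pencilWeight at h
  split_ifs at h <;> omega

theorem pencilWeight_of_val_eq_zero {m : ℕ} {a : Fin (m + 1)} (ha : (a : ℕ) = 0)
    (b c : Fin (m + 1)) :
    pencilWeight m a b c = if (b : ℕ) < m ∧ (b : ℕ) = c then m - b else 0 := by
  simp [pencilWeight, ha]

theorem pencilWeight_of_val_eq_one {m : ℕ} {a : Fin (m + 1)} (ha : (a : ℕ) = 1)
    (b c : Fin (m + 1)) :
    pencilWeight m a b c = if (b : ℕ) < m ∧ (b : ℕ) + 1 = c then (b : ℕ) + 1 else 0 := by
  simp [pencilWeight, ha]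

/-- The two-leg scaling factors that turn the polynomial multiplication tensor into the tensor with
squared coefficients `pencilWeight`. -/
theorem sqrt_choose_mul_eq {m : ℕ} (a b c : Fin (m + 1)) :
    (if (a : ℕ) < 2 ∧ (b : ℕ) < m ∧ (a : ℕ) + b = c then
      √((m - b : ℕ) * (m.choose b) : ℝ) * √((m.choose c : ℝ)⁻¹) else 0) =
      √(pencilWeight m a b c : ℝ) := by
  unfold pencilWeight
  by_cases hb : (b : ℕ) < m
  swap
  · simp [hb]
  have hpos : ∀ i ≤ m, (m.choose i : ℝ) ≠ 0 := fun i hi => by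
    exact_mod_cast (Nat.choose_pos hi).ne'
  by_cases h0 : (a : ℕ) = 0
  · by_cases hc : (b : ℕ) = c
    · rw [if_pos ⟨by omega, hb, by omega⟩, if_pos ⟨h0, hb, hc⟩, ← Real.sqrt_mul (by positivity),
        ← hc, mul_inv_cancel_right₀ (hpos _ hb.le)]
    · rw [if_neg (by omega), if_neg (by omega), if_neg (by omega)]
      simp
  by_cases h1 : (a : ℕ) = 1
  · by_cases hc : (b : ℕ) + 1 = c
    · rw [if_pos ⟨by omega, hb, by omega⟩, if_neg (by omega), if_pos ⟨h1, hb, hc⟩,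
        ← Real.sqrt_mul (by positivity), ← hc]
      congr 1
      rw [← div_eq_mul_inv, div_eq_iff (hpos _ hb)]
      have := Nat.choose_succ_right_eq m b
      exact_mod_cast (show (m - b) * m.choose b = (b + 1) * m.choose (b + 1) by
        rw [mul_comm, ← this, mul_comm])
    · rw [if_neg (by omega), if_neg (by omega), if_neg (by omega)]
      simp
  rw [if_neg (by omega), if_neg (by omega), if_neg (by omega)]
  simp

open KTensor in
-- The legs `A0` and `A1` evaluate monomials at the nodes `0, …, m`, and `A2` interpolates the
-- product, whose degree is at most `m`. The square-root factors are the diagonal scaling.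
theorem exists_mem_closure_glOrbit_unitTensor {k m : ℕ} :
    ∃ S ∈ closure (unitTensor (m + 1) (k + 3)).glOrbit,
      S.IsOrderThree 0 ∧ ∀ a b c, S.entry 0 a b c = (√(pencilWeight m a b c : ℝ) : ℂ) := by
  let V : Matrix (Fin (m + 1)) (Fin (m + 1)) ℂ :=
    (Matrix.vandermonde fun t : Fin (m + 1) => ((t : ℕ) : ℂ)).transpose
  have hV : IsUnit V.det := by
    rw [Matrix.det_transpose, isUnit_iff_ne_zero, Matrix.det_vandermonde_ne_zero_iff]
    intro i j hij
    have hij' : ((i : ℕ) : ℂ) = (j : ℕ) := hij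
    exact Fin.ext (by exact_mod_cast hij')
  let A0 : Matrix (Fin (m + 1)) (Fin (m + 1)) ℂ :=
    Matrix.of fun a t => if (a : ℕ) < 2 then ((t : ℕ) : ℂ) ^ (a : ℕ) else 0
  let A1 : Matrix (Fin (m + 1)) (Fin (m + 1)) ℂ :=
    Matrix.of fun b t => if (b : ℕ) < m then
      (√((m - b : ℕ) * (m.choose b) : ℝ) : ℂ) * ((t : ℕ) : ℂ) ^ (b : ℕ) else 0
  let A2 : Matrix (Fin (m + 1)) (Fin (m + 1)) ℂ :=
    Matrix.of fun c t => (√((m.choose c : ℝ)⁻¹) : ℂ) * V⁻¹ t c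
  -- Every basis vector is sent to `e_0`, which trivializes the factors from the fourth one on.
  let A3 : Matrix (Fin (m + 1)) (Fin (m + 1)) ℂ := Matrix.of fun x _ => if x = 0 then 1 else 0
  refine ⟨matAct (withFirstThree A0 A1 A2 fun _ => A3) _, matAct_mem_closure_glOrbit _ _, ?_, ?_⟩
  · intro x l h0 h1 h2 hx
    rw [matAct_unitTensor_apply]
    refine Finset.sum_eq_zero fun j _ => Finset.prod_eq_zero (Finset.mem_univ l) ?_
    rw [withFirstThree_of_ne _ _ _ _ h0 h1 h2]
    simp [A3, hx]
  · intro a b c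
    rw [entry, matAct_unitTensor_apply, ← sqrt_choose_mul_eq]
    have hprod : ∀ j, ∏ l : Fin (k + 3), withFirstThree A0 A1 A2 (fun _ => A3) l
        (withFirstThree a b c (fun _ => 0) l) j = A0 a j * A1 b j * A2 c j := by
      intro j
      rw [← prod_withFirstThree_one (k := k) (A0 a j) (A1 b j) (A2 c j)]
      refine Finset.prod_congr rfl fun l _ => ?_
      unfold withFirstThree
      split_ifs <;> simp [A3]
    simp_rw [hprod]
    by_cases hab : (a : ℕ) < 2 ∧ (b : ℕ) < m
    -- The product of the monomials `a` and `b` is row `a + b ≤ m` of `V`, so multiplying by `V⁻¹`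
    -- leaves the indicator of `a + b = c`.
    · let i : Fin (m + 1) := ⟨a + b, by omega⟩
      have hterm : ∀ j, A0 a j * A1 b j * A2 c j =
          (√((m - b : ℕ) * (m.choose b) : ℝ) : ℂ) * (√((m.choose c : ℝ)⁻¹) : ℂ) *
            (V i j * V⁻¹ j c) := by
        intro j
        simp only [A0, A1, A2, Matrix.of_apply, if_pos hab.1, if_pos hab.2, V,
          Matrix.transpose_apply, Matrix.vandermonde_apply, i, pow_add]
        ring
      simp_rw [hterm]
      rw [← Finset.mul_sum, ← Matrix.mul_apply, Matrix.mul_nonsing_inv _ hV, Matrix.one_apply]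
      have hic : i = c ↔ (a : ℕ) + b = c := by simp [i, Fin.ext_iff]
      by_cases hc : (a : ℕ) + b = c
      · rw [if_pos (hic.mpr hc), if_pos ⟨hab.1, hab.2, hc⟩]
        push_cast
        ring
      · rw [if_neg (mt hic.mp hc), if_neg (fun h => hc h.2.2)]
        simp
    · rw [if_neg (fun h => hab ⟨h.1, h.2.1⟩)]
      refine Finset.sum_eq_zero fun j _ => ?_
      rcases not_and_or.mp hab with h | h
      · simp only [A0, Matrix.of_apply, if_neg h, zero_mul]
      · simp only [A1, Matrix.of_apply, if_neg h, zero_mul, mul_zero]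

/-! ### Marginal sums of the pencil weights -/

section Sums

variable {m : ℕ}

/-- Each of the two slices sums the integers up to `m`; the factor `2` avoids division in `ℕ`. -/
theorem sum_sum_pencilWeight_left (a : Fin (m + 1)) :
    2 * ∑ b, ∑ c, pencilWeight m a b c = if (a : ℕ) < 2 then m * (m + 1) else 0 := by
  by_cases h0 : (a : ℕ) = 0
  · have h : ∀ b : Fin (m + 1), ∑ c, pencilWeight m a b c = m - b := by
      intro b
      rw [Finset.sum_eq_single b]
      · unfold pencilWeight; split_ifs <;> omega
      · intro c _ hc
        have : (c : ℕ) ≠ b := fun h => hc (Fin.ext h)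
        unfold pencilWeight; split_ifs <;> omega
      · simp
    simp_rw [h]
    have hreflect := Finset.sum_range_reflect (fun b => b) (m + 1)
    rw [add_tsub_cancel_right] at hreflect
    rw [Fin.sum_univ_eq_sum_range (fun b => m - b), hreflect, mul_comm, Finset.sum_range_id_mul_two,
      if_pos (by omega)]
    simp [mul_comm]
  by_cases h1 : (a : ℕ) = 1
  · have h : ∀ b : Fin m, ∑ c, pencilWeight m a b.castSucc c = b + 1 := by
      intro b
      rw [Finset.sum_eq_single b.succ]
      · unfold pencilWeight; simp [h1]
      · intro c _ hc
        have : (c : ℕ) ≠ b + 1 := fun h => hc (Fin.ext h)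
        unfold pencilWeight; simp only [Fin.val_castSucc]; split_ifs <;> omega
      · simp
    have hlast : ∑ c, pencilWeight m a (Fin.last m) c = 0 :=
      Finset.sum_eq_zero fun c _ => by simp [pencilWeight]
    rw [Fin.sum_univ_castSucc, hlast, add_zero]
    simp_rw [h]
    have hshift := Finset.sum_range_succ' (fun b => b) m
    rw [Fin.sum_univ_eq_sum_range (fun b => b + 1), ← add_zero (∑ b ∈ _, _), ← hshift, mul_comm,
      Finset.sum_range_id_mul_two, if_pos (by omega)]
    simp [mul_comm]
  · rw [if_neg (by omega), Finset.sum_eq_zero, mul_zero]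
    intro b _
    exact Finset.sum_eq_zero fun c _ => by simp [pencilWeight, h0, h1]

theorem sum_sum_pencilWeight_middle (hm : 0 < m) (b : Fin (m + 1)) :
    ∑ a, ∑ c, pencilWeight m a b c = if (b : ℕ) < m then m + 1 else 0 := by
  by_cases hb : (b : ℕ) < m
  · rw [Fintype.sum_eq_add (⟨0, by omega⟩ : Fin (m + 1)) ⟨1, by omega⟩ (by simp),
      Finset.sum_eq_single b, Finset.sum_eq_single (⟨b + 1, by omega⟩ : Fin (m + 1))]
    · simp only [pencilWeight, hb]
      simp
      omega
    · intro c _ hc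
      have : (c : ℕ) ≠ b + 1 := fun h => hc (Fin.ext h)
      rw [pencilWeight_of_val_eq_one rfl]; split_ifs <;> omega
    · simp
    · intro c _ hc
      have : (c : ℕ) ≠ b := fun h => hc (Fin.ext h)
      rw [pencilWeight_of_val_eq_zero rfl]; split_ifs <;> omega
    · simp
    · intro a ha
      simp only [ne_eq, Fin.ext_iff] at ha
      exact Finset.sum_eq_zero fun c _ => by simp [pencilWeight, ha]
  · rw [if_neg hb]
    exact Finset.sum_eq_zero fun a _ => Finset.sum_eq_zero fun c _ => by simp [pencilWeight, hb]

theorem sum_sum_pencilWeight_right (hm : 0 < m) (c : Fin (m + 1)) :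
    ∑ a, ∑ b, pencilWeight m a b c = m := by
  rw [Fintype.sum_eq_add (⟨0, by omega⟩ : Fin (m + 1)) ⟨1, by omega⟩ (by simp)]
  · have h0 : ∑ b, pencilWeight m ⟨0, by omega⟩ b c = m - c := by
      rw [Finset.sum_eq_single c]
      · rw [pencilWeight_of_val_eq_zero rfl]; split_ifs <;> omega
      · intro b _ hb
        have : (b : ℕ) ≠ c := fun h => hb (Fin.ext h)
        rw [pencilWeight_of_val_eq_zero rfl]; split_ifs <;> omega
      · simp
    have h1 : ∑ b, pencilWeight m ⟨1, by omega⟩ b c = c := by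
      rw [Finset.sum_eq_single (⟨c - 1, by omega⟩ : Fin (m + 1))]
      · rw [pencilWeight_of_val_eq_one rfl]; dsimp only; split_ifs <;> omega
      · intro b _ hb
        have : (b : ℕ) ≠ c - 1 := fun h => hb (Fin.ext h)
        rw [pencilWeight_of_val_eq_one rfl]; split_ifs <;> omega
      · simp
    rw [h0, h1]
    omega
  · intro a ha
    simp only [ne_eq, Fin.ext_iff] at ha
    exact Finset.sum_eq_zero fun b _ => by simp [pencilWeight, ha]

end Sums

theorem star_sqrt_mul_sqrt (w : ℕ) : star (√(w : ℝ) : ℂ) * (√(w : ℝ) : ℂ) = w := by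
  rw [Complex.star_def, Complex.conj_ofReal, ← Complex.ofReal_mul,
    Real.mul_self_sqrt (Nat.cast_nonneg w)]
  simp

theorem star_sqrt_mul_sqrt_eq_zero {v w : ℕ} (h : v ≠ 0 → w = 0) :
    star (√(v : ℝ) : ℂ) * (√(w : ℝ) : ℂ) = 0 := by
  by_cases hv : v = 0
  · simp [hv]
  · simp [h hv]

open KTensor in
-- The total weight is `m(m + 1)`; dividing the marginal sums by it gives `1/2`, `1/m` and `1/(m +
-- 1)` on the respective supports.
theorem uniformVec_mem_momentPolytope_unitTensor {k m : ℕ} (hm : 0 < m) :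
    (fun l => uniformVec (pencilRanks k m l) (m + 1)) ∈
      (unitTensor (m + 1) (k + 3)).momentPolytope := by
  obtain ⟨S, hS, hord, hent⟩ := exists_mem_closure_glOrbit_unitTensor (k := k) (m := m)
  have hm' : (m : ℂ) ≠ 0 := by exact_mod_cast hm.ne'
  have hm1 : (m : ℂ) + 1 ≠ 0 := by exact_mod_cast m.succ_ne_zero
  have g0 : S.gram 0 = Matrix.diagonal fun a =>
      ((∑ b, ∑ c, pencilWeight m a b c : ℕ) : ℂ) := by
    ext a a'
    rw [hord.gram_zero]
    simp only [hent]
    by_cases h : a = a'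
    · subst h
      simp only [star_sqrt_mul_sqrt, Matrix.diagonal_apply_eq, Nat.cast_sum]
    · rw [Matrix.diagonal_apply_ne _ h]
      refine Finset.sum_eq_zero fun b _ => Finset.sum_eq_zero fun c _ =>
        star_sqrt_mul_sqrt_eq_zero fun h1 => ?_
      by_contra h2
      have := add_eq_of_pencilWeight_ne_zero h1
      have := add_eq_of_pencilWeight_ne_zero h2
      exact h (Fin.ext (by omega))
  have g1 : S.gram 1 = Matrix.diagonal fun b =>
      ((∑ a, ∑ c, pencilWeight m a b c : ℕ) : ℂ) := by
    ext b b'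
    rw [hord.gram_one]
    simp only [hent]
    by_cases h : b = b'
    · subst h
      simp only [star_sqrt_mul_sqrt, Matrix.diagonal_apply_eq, Nat.cast_sum]
    · rw [Matrix.diagonal_apply_ne _ h]
      refine Finset.sum_eq_zero fun a _ => Finset.sum_eq_zero fun c _ =>
        star_sqrt_mul_sqrt_eq_zero fun h1 => ?_
      by_contra h2
      have := add_eq_of_pencilWeight_ne_zero h1
      have := add_eq_of_pencilWeight_ne_zero h2
      exact h (Fin.ext (by omega))
  have g2 : S.gram 2 = Matrix.diagonal fun c =>
      ((∑ a, ∑ b, pencilWeight m a b c : ℕ) : ℂ) := by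
    ext c c'
    rw [hord.gram_two]
    simp only [hent]
    by_cases h : c = c'
    · subst h
      simp only [star_sqrt_mul_sqrt, Matrix.diagonal_apply_eq, Nat.cast_sum]
    · rw [Matrix.diagonal_apply_ne _ h]
      refine Finset.sum_eq_zero fun a _ => Finset.sum_eq_zero fun b _ =>
        star_sqrt_mul_sqrt_eq_zero fun h1 => ?_
      by_contra h2
      have := add_eq_of_pencilWeight_ne_zero h1
      have := add_eq_of_pencilWeight_ne_zero h2
      exact h (Fin.ext (by omega))
  have hτ : ((∑ x, ‖S x‖ ^ 2 : ℝ) : ℂ) = (m : ℂ) * (m + 1) := by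
    rw [← trace_gram S 2, g2]
    simp only [sum_sum_pencilWeight_right hm, Matrix.trace_diagonal]
    simp [mul_comm]
  have hmarg : ∀ l, S.marginal l =
      Matrix.diagonal fun i => (uniformVec (pencilRanks k m l) (m + 1) i : ℂ) := by
    intro l
    have key : ∀ (p : Fin (m + 1) → ℂ), S.gram l = Matrix.diagonal p →
        (∀ i, p i = (m : ℂ) * (m + 1) * (uniformVec (pencilRanks k m l) (m + 1) i : ℂ)) →
        S.marginal l =
          Matrix.diagonal fun i => (uniformVec (pencilRanks k m l) (m + 1) i : ℂ) := by
      intro p hp hpi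
      rw [marginal_eq, hτ, hp, ← Matrix.diagonal_smul]
      congr 1
      funext i
      rw [Pi.smul_apply, hpi, smul_eq_mul, inv_mul_cancel_left₀ (mul_ne_zero hm' hm1)]
    by_cases h0 : l = 0
    · subst h0
      refine key _ g0 fun i => ?_
      have h := congrArg (Nat.cast : ℕ → ℂ) (sum_sum_pencilWeight_left i)
      rw [pencilRanks, withFirstThree_zero, uniformVec]
      split_ifs at h ⊢
      · push_cast at h ⊢
        linear_combination h / 2
      · push_cast at h ⊢
        linear_combination h / 2
    by_cases h1 : l = 1
    · subst h1
      refine key _ g1 fun i => ?_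
      rw [pencilRanks, withFirstThree_one, uniformVec, sum_sum_pencilWeight_middle hm]
      split_ifs
      · push_cast
        field_simp
      · simp
    by_cases h2 : l = 2
    · subst h2
      refine key _ g2 fun i => ?_
      rw [pencilRanks, withFirstThree_two, uniformVec, sum_sum_pencilWeight_right hm,
        if_pos i.isLt]
      push_cast
      field_simp
    · refine key _ (hord.gram_of_ne h0 h1 h2) fun i => ?_
      rw [pencilRanks, withFirstThree_of_ne _ _ _ _ h0 h1 h2, uniformVec, hτ]
      simp only [Nat.lt_one_iff, Fin.val_eq_zero_iff]
      split_ifs <;> simp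
  refine ⟨S, ⟨hS, ?_⟩, ?_⟩
  · rintro rfl
    simp only [Pi.zero_apply, norm_zero] at hτ
    simp [hm', hm1] at hτ
  · funext l
    exact hermitianSpec_eq_of_diagonal _ (antitone_uniformVec _ _) (hmarg l)

theorem zeroPad_uniformVec {k N : ℕ} {d r : Fin k → ℕ} (h : ∀ l, r l ≤ d l) :
    zeroPad (fun _ : Fin k => N) (fun l => uniformVec (r l) (d l)) =
      fun l => uniformVec (r l) N := by
  funext l i
  have := h l
  unfold zeroPad uniformVec
  split_ifs with h1 h2
  · simp [h2]
  · simp [h2]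
  · omega
  · rfl

theorem theorem1p4 (k n c : ℕ) (hk : 3 ≤ k) (hlow : (n : ℤ) ^ 2 - n + 1 < c) (hupp : c ≤ n ^ 2) :
    ¬ (zeroPad (fun _ : Fin k => n ^ 2) '' (unitTensor c k).momentPolytope ⊆
      (immTensor n k).momentPolytope) := by
  intro hsub
  obtain ⟨k, rfl⟩ := Nat.exists_eq_add_of_le' hk
  have hnn : (n : ℤ) ≤ (n : ℤ) ^ 2 := by exact_mod_cast Nat.le_self_pow two_ne_zero n
  obtain ⟨m, rfl⟩ : ∃ m, c = m + 1 := ⟨c - 1, by omega⟩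
  push_cast at hlow
  have hm : 0 < m := by omega
  -- This is where `c > n² - n + 1` enters: the support of the second marginal has codimension less
  -- than `n`.
  have hq : n ^ 2 - m < n := by
    zify [show m ≤ n ^ 2 by omega]
    omega
  refine uniformVec_notMem_momentPolytope_immTensor (k := k) hm hupp hq
    (hsub ⟨_, uniformVec_mem_momentPolytope_unitTensor hm, zeroPad_uniformVec fun l => ?_⟩)
  -- Padding requires all ranks to be at most `c = m + 1`; for the rank `2` this uses `0 < m`.
  unfold pencilRanks withFirstThree
  split_ifs <;> beta_reduce <;> omega
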